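/- \textbf{Proposition.} Let $\mathcal K\subseteq\mathbb R^d$ be a closed convex set, let $(\mathcal X,\rho)$ be a bounded metric space with diameter $\operatorname{diam}(\mathcal X)=\sup_{x,x'}\rho(x,x')$, and let $\{f(\cdot,x)\}_{x\in\mathcal X}$ be a family of convex differentiable functions on $\mathcal K$ with gradients $\nabla f(w,x)$ (with respect to $w\in\mathcal K$) such that, for some $\beta>0$ and $L_{\mathrm{input}}\ge 0$, \begin{itemize} \item ($\beta$-smoothness) $\|\nabla f(w,x)-\nabla f(w',x)\|_2\le\beta\|w-w'\|_2$ for all $w,w'\in\mathcal K$, $x\in\mathcal X$; \item ($L_{\mathrm{input}}$-input-Lipschitz gradients) $\|\nabla f(w,x)-\nabla f(w,x')\|_2\le L_{\mathrm{input}}\,\rho(x,x')$ for all $w\in\mathcal K$, $x,x'\in\mathcal X$. \end{itemize} (If $\mathcal K$ has empty interior, $\nabla f(\cdot,x)$ may be any gradient of $f(\cdot,x)$ relative to $\mathcal K$ with these two properties.) Projected Noisy SGD (PNSGD) with step size $\eta$, noise parameter $\sigma$ and starting point $w_0\in\mathcal K$ maps a dataset $S=(x_1,\dots,x_n)\in\mathcal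 X^n$ to the last iterate $w_n$ of $$w_{i+1}=\Pi_{\mathcal K}\bigl(w_i-\eta\,(\nabla f(w_i,x_{i+1})+Z_{i+1})\bigr),\qquad 0\le i<n,$$ where $Z_1,\dots,Z_n$ are independent with law $\mathcal N(0,\sigma^2 I_d)$ and $\Pi_{\mathcal K}(v)=\arg\min_{\theta\in\mathcal K}\|\theta-v\|_2$. Let $0\le\eta\le 2/\beta$, $\alpha>1$, $\epsilon_L>0$, $w_0\in\mathcal K$, $1\le t\le n$, and $$\sigma^2\ \ge\ \frac{2\alpha L_{\mathrm{input}}^2\operatorname{diam}(\mathcal X)}{\epsilon_L\,(n-t+1)} .$$ Then PNSGD satisfies $(\alpha,\epsilon_L)$-R\'enyi metric differential privacy for the input index $t$: for all datasets $S=(x_1,\dots,x_n)$ and $S'=(x'_1,\dots,x'_n)$ in $\mathcal X^n$ with $x_i=x'_i$ for every $i\ne t$, the output laws $P$ of PNSGD on $S$ and $Q$ of PNSGD on $S'$ satisfy $$D_\alpha(P\|Q)\ \le\ \epsilon_L\,\rho(S,S'),\qquad \rho(S,S')=\sum_{i=1}^n\rho(x_i,x_i')=\rho(x_t,x'_t),$$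 where $D_\alpha(P\|Q)=\frac1{\alpha-1}\log\mathbb E_{x\sim Q}\bigl[\bigl(\tfrac{dP}{dQ}(x)\bigr)^\alpha\bigr]$ if $P\ll Q$, and $D_\alpha(P\|Q)=+\infty$ otherwise. -/

import Mathlib

open MeasureTheory ProbabilityTheory
open scoped ENNReal NNReal

noncomputable section

/-- The Euclidean (`ℓ²`) projection `Π_K(v) = argmin_{θ ∈ K} ‖θ - v‖`. The minimizer exists and is
unique when `K` is nonempty, closed and convex, see `metricProj_spec` and `metricProj_unique`. -/
def metricProj {d : ℕ} (K : Set (EuclideanSpace ℝ (Fin d))) (v : EuclideanSpace ℝ (Fin d)) :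
    EuclideanSpace ℝ (Fin d) :=
  Classical.epsilon fun p => p ∈ K ∧ ∀ θ ∈ K, ‖p - v‖ ≤ ‖θ - v‖

theorem metricProj_spec {d : ℕ} {K : Set (EuclideanSpace ℝ (Fin d))} (hK : IsClosed K)
    (hne : K.Nonempty) (v : EuclideanSpace ℝ (Fin d)) :
    metricProj K v ∈ K ∧ ∀ θ ∈ K, ‖metricProj K v - v‖ ≤ ‖θ - v‖ := by
  apply Classical.epsilon_spec (p := fun p => p ∈ K ∧ ∀ θ ∈ K, ‖p - v‖ ≤ ‖θ - v‖)
  obtain ⟨p, hp, h⟩ := hK.exists_infDist_eq_dist hne v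
  refine ⟨p, hp, fun θ hθ => ?_⟩
  rw [← dist_eq_norm, ← dist_eq_norm, dist_comm p, dist_comm θ, ← h]
  exact Metric.infDist_le_dist_of_mem hθ

theorem metricProj_unique {d : ℕ} {K : Set (EuclideanSpace ℝ (Fin d))} (hK : IsClosed K)
    (hconv : Convex ℝ K) {v p : EuclideanSpace ℝ (Fin d)} (hp : p ∈ K)
    (hmin : ∀ θ ∈ K, ‖p - v‖ ≤ ‖θ - v‖) : metricProj K v = p := by
  obtain ⟨hq, hq'⟩ := metricProj_spec hK ⟨p, hp⟩ v
  set q := metricProj K v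
  have heq : ‖q - v‖ = ‖p - v‖ := le_antisymm (hq' p hp) (hmin q hq)
  have hm := hmin _ (hconv hq hp (by norm_num : (0 : ℝ) ≤ 1 / 2)
    (by norm_num : (0 : ℝ) ≤ 1 / 2) (by norm_num))
  have hpar := parallelogram_law_with_norm ℝ (q - v) (p - v)
  have e1 : q - v + (p - v) = (2 : ℝ) • ((1 / 2 : ℝ) • q + (1 / 2 : ℝ) • p - v) := by
    module
  rw [e1, norm_smul, heq, sub_sub_sub_cancel_right] at hpar
  norm_num at hpar hm
  have : ‖q - p‖ = 0 := by
    nlinarith [norm_nonneg (q - p), norm_nonneg (p - v),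
      norm_nonneg ((1 / 2 : ℝ) • q + (1 / 2 : ℝ) • p - v)]
  exact sub_eq_zero.mp (norm_eq_zero.mp this)

/-- The noise distribution `N(0, σ² I_d)`. -/
def isotropicGaussian (d : ℕ) (σ : ℝ) : Measure (EuclideanSpace ℝ (Fin d)) :=
  multivariateGaussian 0 (σ ^ 2 • (1 : Matrix (Fin d) (Fin d) ℝ))

/-- One step of projected noisy SGD from the point `w` on the data point `x` with noise `z`:
`w ↦ Π_K (w - η (∇f(w, x) + z))`. Here `gradf w x` stands for `∇_w f(w, x)`. -/
def pnsgdStep {d : ℕ} {X : Type*} (K : Set (EuclideanSpace ℝ (Fin d)))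
    (gradf : EuclideanSpace ℝ (Fin d) → X → EuclideanSpace ℝ (Fin d)) (η : ℝ) (x : X)
    (w z : EuclideanSpace ℝ (Fin d)) : EuclideanSpace ℝ (Fin d) :=
  metricProj K (w - η • (gradf w x + z))

/-- The law of the final iterate `w_n` of projected noisy SGD on the dataset `S = (x_1, …, x_n)`
started at `w₀`: the `n`-th step is applied to `w_{n-1}`, with the data point `x_n` and with a fresh
noise `Z ∼ N(0, σ² I_d)` that is independent of `w_{n-1}`. -/
def pnsgdLaw {d : ℕ} {X : Type*} (K : Set (EuclideanSpace ℝ (Fin d)))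
    (gradf : EuclideanSpace ℝ (Fin d) → X → EuclideanSpace ℝ (Fin d)) (η σ : ℝ)
    (w₀ : EuclideanSpace ℝ (Fin d)) :
    (n : ℕ) → (Fin n → X) → Measure (EuclideanSpace ℝ (Fin d))
  | 0, _ => Measure.dirac w₀
  | n + 1, S =>
    ((pnsgdLaw K gradf η σ w₀ n fun i => S i.castSucc).prod (isotropicGaussian d σ)).map
      fun p => pnsgdStep K gradf η (S (Fin.last n)) p.1 p.2

/-- The Rényi divergence of order `α > 1`,
`D_α(P‖Q) = (α - 1)⁻¹ log E_{x ∼ Q} [(dP/dQ (x)) ^ α]`, which is `+∞` unless `P ≪ Q`. -/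
def renyiDiv {Ω : Type*} [MeasurableSpace Ω] (α : ℝ) (P Q : Measure Ω) : EReal :=
  open scoped Classical in
  if P ≪ Q then
    (((α - 1)⁻¹ : ℝ) : EReal) * ENNReal.log (∫⁻ x, (P.rnDeriv Q x) ^ α ∂Q)
  else ⊤

/-- A randomized learner `A` (mapping a dataset to its output distribution) is
`(α, ε)`-Rényi metric differentially private for the input index `t`: for all datasets `S`, `S'`
that agree outside the index `t`, `D_α(A(S)‖A(S')) ≤ ε ρ(S, S')`, where
`ρ(S, S') = ∑ i, ρ(x_i, x'_i)`. -/
def IsRenyiMDPAt {X Ω : Type*} [MetricSpace X] [MeasurableSpace Ω] {n : ℕ}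
    (A : (Fin n → X) → Measure Ω) (α ε : ℝ) (t : Fin n) : Prop :=
  ∀ S S' : Fin n → X, (∀ i, i ≠ t → S i = S' i) →
    renyiDiv α (A S) (A S') ≤ ((ε * ∑ i, dist (S i) (S' i) : ℝ) : EReal)

end

/-! ### Projection onto a convex set, and cocoercivity of gradients relative to it -/

section ConvexAnalysis

variable {d : ℕ} {K : Set (EuclideanSpace ℝ (Fin d))}

/-! The argument is privacy amplification by iteration, run in dual form. A bound `∫ u dP ≤ M (∫ u ^
q dQ) ^ (1/q)` for all test functions `u`, with `q` conjugate to `α`, bounds the `L^α(Q)` norm of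
`dP/dQ` by `M`, hence the Rényi divergence (`renyiDiv_le_of_lintegral_le`). No couplings or shifted
divergences are needed.

Two ingredients give the dual bound. First, each update is a nonexpansive map, minus `η` times
Gaussian noise, followed by a nonexpansive projection (`norm_gradient_step_sub_le`). The classical
proof (cocoercivity of the gradient) evaluates `f` at points that may leave `K`, and if `K` has
empty interior the normal part of the gradient is arbitrary. Since `Π_K` ignores vectors normal to
`K`, only the tangential part is kept; cocoercivity is proved where there is room inside `K`, then
extended by subdividing segments and passing to the boundary.

Second, translating the Gaussian by `a` costs a factor `exp ((α - 1) ‖a‖² / (2σ²))` in the dual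
bound (`shiftBound_isotropicGaussian`). The two runs differ only at step `t`, by at most `δ = η L
ρ`. With `T` steps remaining, including step `t`, each noise variable absorbs `δ / T` of the gap
while the updates never enlarge it (`lintegral_noisyIterationLaw_le`). Multiplying the `T` costs
gives divergence at most `α L² ρ² / (2 T σ²)`; the assumption on `σ` and `ρ ≤ diam` bring this below
`ε ρ`. -/

theorem inner_sub_metricProj_nonpos (hK : IsClosed K) (hc : Convex ℝ K) (hne : K.Nonempty)
    (v : EuclideanSpace ℝ (Fin d)) {θ : EuclideanSpace ℝ (Fin d)} (hθ : θ ∈ K) :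
    inner ℝ (v - metricProj K v) (θ - metricProj K v) ≤ 0 := by
  obtain ⟨hq, hmin⟩ := metricProj_spec hK hne v
  have : Nonempty K := hne.to_subtype
  refine (norm_eq_iInf_iff_real_inner_le_zero hc hq).1 ?_ θ hθ
  refine le_antisymm (le_ciInf fun w => ?_) (ciInf_le ⟨0, ?_⟩ (⟨_, hq⟩ : K))
  · rw [norm_sub_rev, norm_sub_rev v]
    exact hmin w w.2
  · rintro _ ⟨w, rfl⟩
    exact norm_nonneg _

theorem metricProj_eq_of_inner_nonpos (hK : IsClosed K) (hc : Convex ℝ K)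
    {v p : EuclideanSpace ℝ (Fin d)} (hp : p ∈ K)
    (h : ∀ θ ∈ K, inner ℝ (v - p) (θ - p) ≤ 0) : metricProj K v = p := by
  refine metricProj_unique hK hc hp fun θ hθ => ?_
  have h1 := h θ hθ
  have e : θ - v = (θ - p) - (v - p) := by abel
  have h2 := norm_sub_sq_real (θ - p) (v - p)
  rw [real_inner_comm] at h1
  rw [norm_sub_rev p v, e]
  refine le_of_sq_le_sq ?_ (norm_nonneg _)
  nlinarith [sq_nonneg ‖θ - p‖]

theorem metricProj_of_mem (hK : IsClosed K) (hc : Convex ℝ K) {v : EuclideanSpace ℝ (Fin d)}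
    (hv : v ∈ K) : metricProj K v = v :=
  metricProj_eq_of_inner_nonpos hK hc hv (by simp)

/-- The variational inequality at the projection only tests directions `θ - p` with `θ, p ∈ K`, and
these lie in `vectorSpan ℝ K`. This is what allows the normal part of a gradient to be discarded. -/
theorem metricProj_eq_of_sub_mem_orthogonal (hK : IsClosed K) (hc : Convex ℝ K) (hne : K.Nonempty)
    {v v' : EuclideanSpace ℝ (Fin d)} (h : v' - v ∈ (vectorSpan ℝ K)ᗮ) :
    metricProj K v' = metricProj K v := by
  have hq := (metricProj_spec hK hne v).1
  refine metricProj_eq_of_inner_nonpos hK hc hq fun θ hθ => ?_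
  have h1 := inner_sub_metricProj_nonpos hK hc hne v hθ
  have h2 := Submodule.inner_left_of_mem_orthogonal (vsub_mem_vectorSpan ℝ hθ hq) h
  rw [vsub_eq_sub] at h2
  have e : v' - metricProj K v = (v' - v) + (v - metricProj K v) := by abel
  rw [e, inner_add_left, h2, zero_add]
  exact h1

theorem norm_metricProj_sub_le (hK : IsClosed K) (hc : Convex ℝ K) (hne : K.Nonempty)
    (v v' : EuclideanSpace ℝ (Fin d)) : ‖metricProj K v - metricProj K v'‖ ≤ ‖v - v'‖ := by
  have h1 := inner_sub_metricProj_nonpos hK hc hne v (metricProj_spec hK hne v').1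
  have h2 := inner_sub_metricProj_nonpos hK hc hne v' (metricProj_spec hK hne v).1
  set p := metricProj K v
  set q := metricProj K v'
  have e : inner ℝ (v - v') (p - q) = ‖p - q‖ ^ 2 - inner ℝ (v - p) (q - p)
      - inner ℝ (v' - q) (p - q) := by
    rw [← real_inner_self_eq_norm_sq, ← neg_sub p q, inner_neg_right, sub_neg_eq_add,
      ← inner_add_left, ← inner_sub_left]
    congr 1
    abel
  have h3 := real_inner_le_norm (v - v') (p - q)
  by_contra! hlt
  nlinarith [norm_nonneg (v - v'), norm_nonneg (p - q)]

variable {E : Type*} [NormedAddCommGroup E] [InnerProductSpace ℝ E] [CompleteSpace E]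

theorem hasDerivWithinAt_comp_segment {s : Set E} (hs : Convex ℝ s) {f : E → ℝ} {G : E → E}
    (hG : ∀ w ∈ s, HasGradientWithinAt f (G w) s w) {x z : E} (hx : x ∈ s) (hz : z ∈ s)
    {τ : ℝ} (hτ : τ ∈ Set.Icc (0 : ℝ) 1) :
    HasDerivWithinAt (fun τ : ℝ => f (x + τ • (z - x)))
      (inner ℝ (G (x + τ • (z - x))) (z - x)) (Set.Icc 0 1) τ := by
  have hmaps : Set.MapsTo (fun τ : ℝ => x + τ • (z - x)) (Set.Icc 0 1) s :=
    fun u hu => hs.add_smul_sub_mem hx hz hu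
  have h1 : HasDerivWithinAt (fun τ : ℝ => x + τ • (z - x)) (z - x) (Set.Icc 0 1) τ := by
    simpa using (((hasDerivAt_id τ).smul_const (z - x)).const_add x).hasDerivWithinAt
  have h2 := (hG _ (hmaps hτ)).hasFDerivWithinAt.comp_hasDerivWithinAt τ h1 hmaps
  simpa [Function.comp_def] using h2

theorem ConvexOn.add_inner_gradient_le {s : Set E} {f : E → ℝ} (hf : ConvexOn ℝ s f) {G : E → E}
    (hG : ∀ w ∈ s, HasGradientWithinAt f (G w) s w) {x z : E} (hx : x ∈ s) (hz : z ∈ s) :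
    f x + inner ℝ (G x) (z - x) ≤ f z := by
  have hd := hasDerivWithinAt_comp_segment hf.1 hG hx hz (τ := 0) (by simp)
  have hconv : ConvexOn ℝ (Set.Icc (0 : ℝ) 1) (fun τ : ℝ => f (x + τ • (z - x))) := by
    have := hf.comp_affineMap (AffineMap.lineMap x z)
    refine (this.subset (s := Set.Icc (0 : ℝ) 1) ?_ (convex_Icc _ _)).congr ?_
    · intro u hu
      simpa [AffineMap.lineMap_apply, add_comm] using hf.1.add_smul_sub_mem hx hz hu
    · intro u _
      simp [AffineMap.lineMap_apply, add_comm]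
  have := hconv.le_slope_of_hasDerivWithinAt (x := 0) (y := 1) (by simp) (by simp) one_pos hd
  simp [slope_def_field] at this
  linarith

/-- Descent lemma: along the segment, `f` minus the claimed quadratic upper bound has nonpositive
derivative, by Cauchy–Schwarz and the Lipschitz bound on `G`. -/
theorem le_add_inner_gradient_add_sq {s : Set E} (hs : Convex ℝ s) {f : E → ℝ} {G : E → E}
    (hG : ∀ w ∈ s, HasGradientWithinAt f (G w) s w) {β : ℝ≥0} (hL : LipschitzOnWith β G s)
    {x z : E} (hx : x ∈ s) (hz : z ∈ s) :
    f z ≤ f x + inner ℝ (G x) (z - x) + β / 2 * ‖z - x‖ ^ 2 := by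
  have hd : ∀ τ ∈ Set.Icc (0 : ℝ) 1, HasDerivWithinAt
      (fun τ : ℝ => f (x + τ • (z - x)) - (τ * inner ℝ (G x) (z - x)
        + β / 2 * ‖z - x‖ ^ 2 * τ ^ 2))
      (inner ℝ (G (x + τ • (z - x))) (z - x) - (inner ℝ (G x) (z - x)
        + β * ‖z - x‖ ^ 2 * τ)) (Set.Icc 0 1) τ := by
    intro τ hτ
    refine (hasDerivWithinAt_comp_segment hs hG hx hz hτ).sub ?_
    have h1 := ((hasDerivAt_id τ).mul_const (inner ℝ (G x) (z - x))).add
      ((hasDerivAt_pow 2 τ).const_mul (β / 2 * ‖z - x‖ ^ 2))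
    refine (h1.congr_deriv ?_).hasDerivWithinAt
    simp
    ring
  have hanti := antitoneOn_of_hasDerivWithinAt_nonpos (convex_Icc (0 : ℝ) 1)
    (fun τ hτ => (hd τ hτ).continuousWithinAt)
    (fun τ hτ => (hd τ (interior_subset hτ)).mono interior_subset) ?_
  · have := hanti (a := 0) (b := 1) (by simp) (by simp) zero_le_one
    simp at this
    linarith
  · intro τ hτ
    have hτ := interior_subset hτ
    have h1 := hL.norm_sub_le (hs.add_smul_sub_mem hx hz hτ) hx
    rw [add_sub_cancel_left, norm_smul, Real.norm_of_nonneg hτ.1] at h1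
    have h2 := real_inner_le_norm (G (x + τ • (z - x)) - G x) (z - x)
    rw [inner_sub_left] at h2
    nlinarith [norm_nonneg (z - x)]

/-- Baillon–Haddad cocoercivity, localized and restricted to directions in `V`. The convexity bound
from `x` and the descent bound from `y` are compared at `y + β⁻¹ g`, with `g` the difference of
projected gradients; adding the version with `x` and `y` exchanged gives the claim. That point is
within `‖x - y‖` of `y`, which is why this much room is assumed. -/
theorem norm_sq_projection_gradient_sub_le {s : Set E} {f : E → ℝ} (hf : ConvexOn ℝ s f)
    {G : E → E} (hG : ∀ w ∈ s, HasGradientWithinAt f (G w) s w) {β : ℝ≥0} (hβ : 0 < β)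
    (hL : LipschitzOnWith β G s) (V : Submodule ℝ E) [V.HasOrthogonalProjection] {x y : E}
    (hx : x ∈ s) (hy : y ∈ s) (hxV : ∀ v ∈ V, ‖v‖ ≤ ‖x - y‖ → x + v ∈ s)
    (hyV : ∀ v ∈ V, ‖v‖ ≤ ‖x - y‖ → y + v ∈ s) :
    ‖V.starProjection (G x) - V.starProjection (G y)‖ ^ 2
      ≤ β * inner ℝ (G x - G y) (x - y) := by
  have hβ' : (0 : ℝ) < β := hβ
  have key : ∀ x y : E, x ∈ s → y ∈ s → (∀ v ∈ V, ‖v‖ ≤ ‖x - y‖ → y + v ∈ s) →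
      f x - f y + inner ℝ (G x) (y - x)
        + (2 * β : ℝ)⁻¹ * ‖V.starProjection (G x) - V.starProjection (G y)‖ ^ 2 ≤ 0 := by
    intro x y hx hy hyV
    set g := V.starProjection (G x) - V.starProjection (G y) with hg
    have hgV : g ∈ V := V.sub_mem (by simp) (by simp)
    have hgn : ‖g‖ ≤ β * ‖x - y‖ := by
      rw [hg, ← map_sub]
      exact (V.norm_starProjection_apply_le _).trans (hL.norm_sub_le hx hy)
    have hz := hyV ((β : ℝ)⁻¹ • g) (V.smul_mem _ hgV) (by
      rw [norm_smul, norm_inv, Real.norm_of_nonneg hβ'.le, inv_mul_le_iff₀ hβ']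
      exact hgn)
    have h1 := hf.add_inner_gradient_le hG hx hz
    have h2 := le_add_inner_gradient_add_sq hf.1 hG hL hy hz
    have h3 : inner ℝ (G x - G y) g = ‖g‖ ^ 2 := by
      rw [← real_inner_self_eq_norm_sq]
      nth_rw 2 [hg]
      rw [← map_sub, Submodule.inner_starProjection_left_eq_right,
        Submodule.starProjection_eq_self_iff.2 hgV]
    rw [inner_sub_left] at h3
    have e : y + (β : ℝ)⁻¹ • g - x = (y - x) + (β : ℝ)⁻¹ • g := by abel
    rw [e, inner_add_right, inner_smul_right] at h1
    rw [add_sub_cancel_left, inner_smul_right, norm_smul, norm_inv,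
      Real.norm_of_nonneg hβ'.le] at h2
    have e2 : (β : ℝ) / 2 * ((β : ℝ)⁻¹ * ‖g‖) ^ 2 = (2 * β : ℝ)⁻¹ * ‖g‖ ^ 2 := by
      field_simp
    have e3 : (β : ℝ)⁻¹ * ‖g‖ ^ 2 = 2 * ((2 * β : ℝ)⁻¹ * ‖g‖ ^ 2) := by
      field_simp
    rw [e2] at h2
    have h4 : (β : ℝ)⁻¹ * inner ℝ (G x) g - (β : ℝ)⁻¹ * inner ℝ (G y) g
        = 2 * ((2 * β : ℝ)⁻¹ * ‖g‖ ^ 2) := by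
      rw [← mul_sub, h3, e3]
    linarith
  have h1 := key x y hx hy hyV
  have h2 := key y x hy hx (by rwa [norm_sub_rev])
  rw [norm_sub_rev] at h2
  have e : inner ℝ (G x - G y) (x - y) = - inner ℝ (G x) (y - x) - inner ℝ (G y) (x - y) := by
    rw [← neg_sub x y, inner_neg_right, inner_sub_left]
    ring
  have e2 : ((2 * β : ℝ)⁻¹ * ‖V.starProjection (G x) - V.starProjection (G y)‖ ^ 2)
      + ((2 * β : ℝ)⁻¹ * ‖V.starProjection (G x) - V.starProjection (G y)‖ ^ 2)
      = (β : ℝ)⁻¹ * ‖V.starProjection (G x) - V.starProjection (G y)‖ ^ 2 := by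
    field_simp
    ring
  rw [← inv_mul_le_iff₀ hβ', e]
  linarith

end ConvexAnalysis

/-! ### Nonexpansiveness of the tangential gradient step -/

section GradientStep

variable {E : Type*} [NormedAddCommGroup E] [InnerProductSpace ℝ E]

theorem norm_sub_le_of_norm_sub_le_on_short_segments {φ : E → E} {x y : E} {r : ℝ} (hr : 0 < r)
    (h : ∀ u ∈ segment ℝ x y, ∀ v ∈ segment ℝ x y, ‖u - v‖ ≤ r → ‖φ u - φ v‖ ≤ ‖u - v‖) :
    ‖φ x - φ y‖ ≤ ‖x - y‖ := by
  obtain ⟨N, hN⟩ := exists_nat_gt (‖y - x‖ / r)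
  have hN0 : (0 : ℝ) < N := lt_of_le_of_lt (by positivity) hN
  set p : ℕ → E := fun i => x + ((i : ℝ) / N) • (y - x) with hp
  have hmem : ∀ i ≤ N, p i ∈ segment ℝ x y := by
    intro i hi
    rw [segment_eq_image']
    refine ⟨(i : ℝ) / N, ⟨by positivity, ?_⟩, rfl⟩
    rw [div_le_one hN0]
    exact_mod_cast hi
  have hstep : ∀ i, ‖p i - p (i + 1)‖ = ‖y - x‖ / N := by
    intro i
    have e : p i - p (i + 1) = (-(1 / N : ℝ)) • (y - x) := by
      simp only [hp, Nat.cast_add, Nat.cast_one]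
      module
    rw [e, norm_smul, norm_neg, Real.norm_of_nonneg (by positivity)]
    ring
  have hsmall : ‖y - x‖ / N ≤ r := by
    rw [div_le_iff₀ hN0]
    rw [div_lt_iff₀ hr] at hN
    linarith
  have hsum := dist_le_range_sum_dist (fun i => φ (p i)) N
  have h0 : p 0 = x := by simp [hp]
  have h1 : p N = y := by simp [hp, hN0.ne']
  rw [h0, h1, dist_eq_norm] at hsum
  calc ‖φ x - φ y‖ ≤ ∑ i ∈ Finset.range N, dist (φ (p i)) (φ (p (i + 1))) := hsum
    _ ≤ ∑ _i ∈ Finset.range N, ‖y - x‖ / N := by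
        refine Finset.sum_le_sum fun i hi => ?_
        have hi := Finset.mem_range.1 hi
        rw [dist_eq_norm, ← hstep i]
        exact h _ (hmem i hi.le) _ (hmem (i + 1) hi) ((hstep i).trans_le hsmall)
    _ = ‖x - y‖ := by
        rw [Finset.sum_const, Finset.card_range, nsmul_eq_mul, norm_sub_rev]
        field_simp

theorem Convex.exists_forall_mem_vectorSpan_add_mem [FiniteDimensional ℝ E] {s : Set E}
    (hs : Convex ℝ s) (hne : s.Nonempty) :
    ∃ p ∈ s, ∃ r > 0, ∀ v ∈ vectorSpan ℝ s, ‖v‖ ≤ r → p + v ∈ s := by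
  obtain ⟨p, hp⟩ := hne.intrinsicInterior hs
  obtain ⟨⟨p', hp'⟩, hint, rfl⟩ := mem_intrinsicInterior.1 hp
  obtain ⟨r, hr, hball⟩ := Metric.mem_nhds_iff.1 (mem_interior_iff_mem_nhds.1 hint)
  refine ⟨p', intrinsicInterior_subset hp, r / 2, by positivity, fun v hv hvr => ?_⟩
  have hmem : p' + v ∈ affineSpan ℝ s := by
    rw [← direction_affineSpan] at hv
    simpa [add_comm] using AffineSubspace.vadd_mem_of_mem_direction hv hp'
  have : (⟨p' + v, hmem⟩ : affineSpan ℝ s) ∈ Metric.ball ⟨p', hp'⟩ r := by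
    rw [Metric.mem_ball, Subtype.dist_eq, dist_eq_norm]
    simp only [add_sub_cancel_left]
    linarith
  exact hball this

/-- Moving a fraction `τ` towards a point with room `r` in the directions of `V` produces a point
with room `τ r`. -/
theorem Convex.add_mem_of_combo {s : Set E} (hs : Convex ℝ s) {V : Submodule ℝ E} {p : E} {r : ℝ}
    (hr : ∀ v ∈ V, ‖v‖ ≤ r → p + v ∈ s) {x : E} (hx : x ∈ s) {τ : ℝ} (hτ : 0 < τ) (hτ1 : τ ≤ 1)
    {v : E} (hv : v ∈ V) (hvr : ‖v‖ ≤ τ * r) : (1 - τ) • x + τ • p + v ∈ s := by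
  have h := hs hx (hr (τ⁻¹ • v) (V.smul_mem _ hv) (by
    rw [norm_smul, norm_inv, Real.norm_of_nonneg hτ.le, inv_mul_le_iff₀ hτ]
    exact hvr)) (sub_nonneg.2 hτ1) hτ.le (by ring)
  rwa [smul_add, smul_inv_smul₀ hτ.ne', ← add_assoc] at h

theorem norm_gradient_step_sub_le [FiniteDimensional ℝ E] {s : Set E} {f : E → ℝ}
    (hf : ConvexOn ℝ s f) {G : E → E} (hG : ∀ w ∈ s, HasGradientWithinAt f (G w) s w)
    {β : ℝ≥0} (hβ : 0 < β) (hL : LipschitzOnWith β G s) {η : ℝ} (hη0 : 0 ≤ η) (hη : η ≤ 2 / β)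
    {x y : E} (hx : x ∈ s) (hy : y ∈ s) :
    ‖(x - η • (vectorSpan ℝ s).starProjection (G x))
      - (y - η • (vectorSpan ℝ s).starProjection (G y))‖ ≤ ‖x - y‖ := by
  have hβ' : (0 : ℝ) < β := hβ
  have hs := hf.1
  set V := vectorSpan ℝ s with hV
  set φ : E → E := fun w => w - η • V.starProjection (G w) with hφ
  have hsub : ∀ a ∈ s, ∀ b ∈ s, a - b ∈ V := fun a ha b hb => vsub_mem_vectorSpan ℝ ha hb
  have hlocal : ∀ u ∈ s, ∀ v ∈ s, (∀ z ∈ V, ‖z‖ ≤ ‖u - v‖ → u + z ∈ s) →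
      (∀ z ∈ V, ‖z‖ ≤ ‖u - v‖ → v + z ∈ s) → ‖φ u - φ v‖ ≤ ‖u - v‖ := by
    intro u hu v hv huz hvz
    have hco := norm_sq_projection_gradient_sub_le hf hG hβ hL V hu hv huz hvz
    set g := V.starProjection (G u) - V.starProjection (G v) with hg
    have hin : inner ℝ (u - v) g = inner ℝ (G u - G v) (u - v) := by
      rw [hg, ← map_sub, ← Submodule.inner_starProjection_left_eq_right,
        Submodule.starProjection_eq_self_iff.2 (hsub u hu v hv), real_inner_comm]
    have e : φ u - φ v = (u - v) - η • g := by
      simp only [hφ, hg]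
      module
    rw [e]
    refine le_of_sq_le_sq ?_ (norm_nonneg _)
    rw [norm_sub_sq_real, inner_smul_right, norm_smul, Real.norm_of_nonneg hη0, hin]
    -- Expanding the square, `‖u - v‖² - ‖φ u - φ v‖² = η (2 ⟪G u - G v, u - v⟫ - η ‖g‖²)`;
    -- cocoercivity and `η β ≤ 2` make the bracket nonnegative.
    have h2 : η * β ≤ 2 := (le_div_iff₀ hβ').1 hη
    have h3 : 0 ≤ inner ℝ (G u - G v) (u - v) := by
      by_contra! hneg
      nlinarith [sq_nonneg ‖g‖]
    have h4 : η * ‖g‖ ^ 2 ≤ 2 * inner ℝ (G u - G v) (u - v) := by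
      calc η * ‖g‖ ^ 2 ≤ η * (β * inner ℝ (G u - G v) (u - v)) := by gcongr
        _ = (η * β) * inner ℝ (G u - G v) (u - v) := by ring
        _ ≤ _ := by gcongr
    nlinarith [mul_le_mul_of_nonneg_left h4 hη0]
  obtain ⟨p, hps, r, hr, hpr⟩ := hs.exists_forall_mem_vectorSpan_add_mem ⟨x, hx⟩
  -- Both endpoints are contracted towards the relative interior point `p`, so the whole segment
  -- between them has uniform room `τ r` and short pieces satisfy the local estimate. Letting `τ →
  -- 0` recovers `x` and `y`.
  have hinner : ∀ τ : ℝ, 0 < τ → τ ≤ 1 →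
      ‖φ ((1 - τ) • x + τ • p) - φ ((1 - τ) • y + τ • p)‖
        ≤ ‖((1 - τ) • x + τ • p) - ((1 - τ) • y + τ • p)‖ := by
    intro τ hτ hτ1
    have hball : ∀ u ∈ segment ℝ ((1 - τ) • x + τ • p) ((1 - τ) • y + τ • p), ∀ v ∈ V,
        ‖v‖ ≤ τ * r → u + v ∈ s := by
      rintro _ ⟨a, b, ha, hb, hab, rfl⟩ v hv hvr
      have := hs.add_mem_of_combo hpr (hs hx hy ha hb hab) hτ hτ1 hv hvr
      convert this using 2
      have ha' : a = 1 - b := by linarith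
      rw [ha']
      module
    have hr' : 0 < τ * r := by positivity
    refine norm_sub_le_of_norm_sub_le_on_short_segments hr' fun u hu v hv huv => ?_
    have hu0 := hball u hu 0 V.zero_mem (by simpa using hr'.le)
    have hv0 := hball v hv 0 V.zero_mem (by simpa using hr'.le)
    rw [add_zero] at hu0 hv0
    exact hlocal u hu0 v hv0 (fun z hz hzn => hball u hu z hz (hzn.trans huv))
      (fun z hz hzn => hball v hv z hz (hzn.trans huv))
  have hcont : ContinuousOn φ s :=
    continuousOn_id.sub ((V.starProjection.continuous.comp_continuousOn hL.continuousOn).const_smul η)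
  have hpath : ∀ z ∈ s, Filter.Tendsto (fun τ : ℝ => φ ((1 - τ) • z + τ • p))
      (nhdsWithin 0 (Set.Ioc 0 1)) (nhds (φ z)) := by
    intro z hz
    refine (hcont z hz).tendsto.comp (tendsto_nhdsWithin_iff.2 ⟨?_, ?_⟩)
    · have hc : Continuous fun τ : ℝ => (1 - τ) • z + τ • p := by fun_prop
      simpa using (hc.tendsto 0).mono_left nhdsWithin_le_nhds
    · filter_upwards [self_mem_nhdsWithin] with τ hτ
      exact hs hz hps (sub_nonneg.2 hτ.2) hτ.1.le (by ring)
  have hpath' : Filter.Tendsto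
      (fun τ : ℝ => ‖((1 - τ) • x + τ • p) - ((1 - τ) • y + τ • p)‖)
      (nhdsWithin 0 (Set.Ioc 0 1)) (nhds ‖x - y‖) := by
    have hc : Continuous fun τ : ℝ => ‖((1 - τ) • x + τ • p) - ((1 - τ) • y + τ • p)‖ := by
      fun_prop
    simpa using (hc.tendsto 0).mono_left nhdsWithin_le_nhds
  have : (nhdsWithin (0 : ℝ) (Set.Ioc 0 1)).NeBot := by
    rw [nhdsWithin_Ioc_eq_nhdsGT one_pos]
    infer_instance
  refine le_of_tendsto_of_tendsto ((hpath x hx).sub (hpath y hy)).norm hpath' ?_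
  filter_upwards [self_mem_nhdsWithin] with τ hτ
  exact hinner τ hτ.1 hτ.2

end GradientStep

/-! ### Cost of translating a Gaussian, in dual form -/

section GaussianShift

/-- The translate of `μ` by `a` has a density with respect to `μ` whose `L^p` norm is at most `C`,
where `p` is the exponent conjugate to `q`; this is expressed by duality. -/
def ShiftBound {G : Type*} [MeasurableSpace G] [Add G] (μ : Measure G) (q : ℝ) (a : G)
    (C : ℝ≥0∞) : Prop :=
  ∀ F : G → ℝ≥0∞, Measurable F → ∫⁻ x, F (x + a) ∂μ ≤ C * (∫⁻ x, F x ^ q ∂μ) ^ (1 / q)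

/-- The translate has density `exp (a x - a² / 2)`; Hölder reduces the bound to the `p`-th moment of
this density, which the Gaussian moment generating function evaluates. -/
theorem shiftBound_gaussianReal {p q : ℝ} (hpq : p.HolderConjugate q) (a : ℝ) :
    ShiftBound (gaussianReal 0 1) q a (ENNReal.ofReal (Real.exp ((p - 1) * a ^ 2 / 2))) := by
  intro F hF
  have hp := hpq.pos
  have hpdf : ∀ x, gaussianPDF a 1 x
      = gaussianPDF 0 1 x * ENNReal.ofReal (Real.exp (a * x - a ^ 2 / 2)) := by
    intro x
    simp only [gaussianPDF, gaussianPDFReal]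
    rw [← ENNReal.ofReal_mul (by positivity), mul_assoc _ (Real.exp _), ← Real.exp_add]
    congr 3
    simp
    ring
  have hshift : ∫⁻ x, F (x + a) ∂(gaussianReal 0 1)
      = ∫⁻ x, ENNReal.ofReal (Real.exp (a * x - a ^ 2 / 2)) * F x ∂(gaussianReal 0 1) := by
    rw [← lintegral_map (f := F) hF (measurable_add_const a), gaussianReal_map_add_const, zero_add,
      gaussianReal_of_var_ne_zero _ one_ne_zero, gaussianReal_of_var_ne_zero _ one_ne_zero,
      lintegral_withDensity_eq_lintegral_mul _ (measurable_gaussianPDF _ _) hF,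
      lintegral_withDensity_eq_lintegral_mul _ (measurable_gaussianPDF _ _) (by fun_prop)]
    simp only [Pi.mul_apply, hpdf, mul_assoc]
  have hmgf : ∫⁻ x, ENNReal.ofReal (Real.exp (a * x - a ^ 2 / 2)) ^ p ∂(gaussianReal 0 1)
      = ENNReal.ofReal (Real.exp (p * ((p - 1) * a ^ 2 / 2))) := by
    have e : ∀ x : ℝ, ENNReal.ofReal (Real.exp (a * x - a ^ 2 / 2)) ^ p
        = ENNReal.ofReal (Real.exp (-(p * a ^ 2 / 2))) * ENNReal.ofReal (Real.exp (p * a * x)) := by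
      intro x
      rw [ENNReal.ofReal_rpow_of_pos (Real.exp_pos _), ← Real.exp_mul,
        ← ENNReal.ofReal_mul (Real.exp_pos _).le, ← Real.exp_add]
      congr 2
      ring
    have hm := congrFun (mgf_fun_id_gaussianReal (μ := 0) (v := 1)) (p * a)
    rw [mgf] at hm
    simp_rw [e]
    rw [lintegral_const_mul _ (by fun_prop), ← ofReal_integral_eq_lintegral_ofReal
      (integrable_exp_mul_gaussianReal _) (by filter_upwards with x using (Real.exp_pos _).le), hm,
      ← ENNReal.ofReal_mul (Real.exp_pos _).le, ← Real.exp_add]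
    congr 2
    simp
    ring
  rw [hshift]
  refine (ENNReal.lintegral_mul_le_Lp_mul_Lq _ hpq (by fun_prop) hF.aemeasurable).trans_eq ?_
  rw [hmgf, ENNReal.ofReal_rpow_of_pos (Real.exp_pos _), ← Real.exp_mul]
  congr 3
  field_simp

/-- The bound for `ν` is applied on each fibre, then the bound for `μ` to the fibrewise `L^q` norm,
so constants multiply. -/
theorem ShiftBound.prod {G H : Type*} [MeasurableSpace G] [MeasurableSpace H] [Add G] [Add H]
    [MeasurableAdd G] [MeasurableAdd H] {μ : Measure G} {ν : Measure H} [SFinite μ] [SFinite ν]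
    {q : ℝ} (hq : 0 < q) {a : G} {b : H} {C D : ℝ≥0∞} (hμ : ShiftBound μ q a C)
    (hν : ShiftBound ν q b D) : ShiftBound (μ.prod ν) q (a, b) (C * D) := by
  intro F hF
  have hFq : Measurable fun z => F z ^ q := hF.pow_const q
  have hin : Measurable fun x => ∫⁻ y, F (x, y) ^ q ∂ν := hFq.lintegral_prod_right'
  have hshift : Measurable fun z : G × H => F (z + (a, b)) :=
    hF.comp (((measurable_add_const a).comp measurable_fst).prodMk
      ((measurable_add_const b).comp measurable_snd))
  rw [lintegral_prod _ hshift.aemeasurable, lintegral_prod _ hFq.aemeasurable]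
  calc ∫⁻ x, ∫⁻ y, F ((x, y) + (a, b)) ∂ν ∂μ
      ≤ ∫⁻ x, D * (∫⁻ y, F (x + a, y) ^ q ∂ν) ^ (1 / q) ∂μ :=
        lintegral_mono fun x => hν (fun y => F (x + a, y)) (hF.comp measurable_prodMk_left)
    _ = D * ∫⁻ x, (∫⁻ y, F (x + a, y) ^ q ∂ν) ^ (1 / q) ∂μ :=
        lintegral_const_mul _ ((hin.comp (measurable_add_const a)).pow_const _)
    _ ≤ D * (C * (∫⁻ x, ((∫⁻ y, F (x, y) ^ q ∂ν) ^ (1 / q)) ^ q ∂μ) ^ (1 / q)) := by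
        gcongr
        exact hμ (fun x => (∫⁻ y, F (x, y) ^ q ∂ν) ^ (1 / q)) (hin.pow_const _)
    _ = C * D * (∫⁻ x, ∫⁻ y, F (x, y) ^ q ∂ν ∂μ) ^ (1 / q) := by
        simp_rw [← ENNReal.rpow_mul, one_div_mul_cancel hq.ne', ENNReal.rpow_one]
        ring

theorem ShiftBound.map {G H : Type*} [MeasurableSpace G] [MeasurableSpace H] [Add G] [Add H]
    [MeasurableAdd H] {μ : Measure G} {q : ℝ} {a : G} {C : ℝ≥0∞} (h : ShiftBound μ q a C)
    {T : G → H} (hT : Measurable T) {b : H} (hadd : ∀ x, T (x + a) = T x + b) :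
    ShiftBound (μ.map T) q b C := by
  intro F hF
  rw [lintegral_map (f := fun x => F (x + b)) (hF.comp (measurable_add_const b)) hT,
    lintegral_map (hF.pow_const q) hT]
  simp_rw [← hadd]
  exact h (F ∘ T) (hF.comp hT)

theorem shiftBound_pi_gaussianReal {p q : ℝ} (hpq : p.HolderConjugate q) :
    ∀ (n : ℕ) (a : Fin n → ℝ), ShiftBound (Measure.pi fun _ : Fin n => gaussianReal 0 1) q a
      (ENNReal.ofReal (Real.exp ((p - 1) * (∑ i, a i ^ 2) / 2)))
  | 0, a => by
    intro F hF
    have hq := hpq.symm.pos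
    rw [Measure.pi_of_empty, lintegral_dirac' _ (hF.pow_const q),
      lintegral_dirac' (f := fun x => F (x + a)) _ (hF.comp (measurable_add_const a)),
      ← ENNReal.rpow_mul, mul_one_div_cancel hq.ne', ENNReal.rpow_one]
    simp
    exact le_of_eq (congrArg F (Subsingleton.elim _ _))
  | n + 1, a => by
    have h := (shiftBound_gaussianReal hpq (a 0)).prod hpq.symm.pos
      (shiftBound_pi_gaussianReal hpq n fun i => a i.succ)
    have hmp := (measurePreserving_piFinSuccAbove (fun _ : Fin (n + 1) => gaussianReal 0 1) 0).symm
    have h' := h.map (T := (MeasurableEquiv.piFinSuccAbove (fun _ : Fin (n + 1) => ℝ) 0).symm)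
      (MeasurableEquiv.measurable _) (b := a) (by
        intro x
        ext i
        refine Fin.cases ?_ (fun j => ?_) i <;>
          simp [MeasurableEquiv.piFinSuccAbove, Fin.insertNthEquiv])
    rw [hmp.map_eq, ← ENNReal.ofReal_mul (Real.exp_pos _).le, ← Real.exp_add] at h'
    rw [Fin.sum_univ_succ]
    convert h' using 3
    ring

theorem isotropicGaussian_eq_map (d : ℕ) (σ : ℝ) :
    isotropicGaussian d σ
      = (Measure.pi fun _ : Fin d => gaussianReal 0 1).map (fun x => σ • WithLp.toLp 2 x) := by
  have e : (fun x : Fin d → ℝ => σ • WithLp.toLp 2 x)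
      = (fun y : EuclideanSpace ℝ (Fin d) => σ • y) ∘ WithLp.toLp 2 := rfl
  rw [e, ← Measure.map_map (by fun_prop) (by fun_prop), map_pi_eq_stdGaussian]
  have hS : (σ ^ 2 • (1 : Matrix (Fin d) (Fin d) ℝ)).PosSemidef :=
    Matrix.PosSemidef.one.smul (sq_nonneg σ)
  have : IsProbabilityMeasure ((stdGaussian (EuclideanSpace ℝ (Fin d))).map fun y => σ • y) :=
    Measure.isProbabilityMeasure_map (by fun_prop)
  unfold isotropicGaussian
  refine Measure.ext_of_charFun ?_
  ext x
  rw [charFun_multivariateGaussian hS, charFun_map_smul, charFun_stdGaussian, norm_smul,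
    ← Complex.ofReal_pow, mul_pow, EuclideanSpace.norm_sq_eq]
  congr 1
  simp [Matrix.smul_mulVec, dotProduct]
  ring_nf
  simp [Finset.mul_sum, mul_comm]

instance (d : ℕ) (σ : ℝ) : IsProbabilityMeasure (isotropicGaussian d σ) := by
  unfold isotropicGaussian
  infer_instance

theorem shiftBound_isotropicGaussian {p q : ℝ} (hpq : p.HolderConjugate q) {d : ℕ} {σ : ℝ}
    (hσ : σ ≠ 0) (a : EuclideanSpace ℝ (Fin d)) :
    ShiftBound (isotropicGaussian d σ) q a
      (ENNReal.ofReal (Real.exp ((p - 1) * ‖a‖ ^ 2 / (2 * σ ^ 2)))) := by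
  rw [isotropicGaussian_eq_map]
  have h := (shiftBound_pi_gaussianReal hpq d (WithLp.ofLp (σ⁻¹ • a))).map
    (T := fun x => σ • WithLp.toLp 2 x) (by fun_prop) (b := a) (by
      intro x
      rw [WithLp.toLp_add, smul_add, WithLp.toLp_ofLp, smul_inv_smul₀ hσ])
  convert h using 3
  rw [EuclideanSpace.norm_sq_eq]
  simp [mul_pow, ← Finset.mul_sum]
  field_simp

end GaussianShift

/-! ### Dual amplification bound for noisy nonexpansive iterations -/

section NoisyIteration

variable {E : Type*} [NormedAddCommGroup E] [NormedSpace ℝ E] [MeasurableSpace E]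

/-- The law of the last iterate of `w_{i+1} = P (φ_i w_i - η Z_{i+1})`, started at `w₀`, where the
`Z_i` are independent with law `ν`. -/
noncomputable def noisyIterationLaw (P : E → E) (ν : Measure E) (η : ℝ) (w₀ : E) :
    (n : ℕ) → (Fin n → E → E) → Measure E
  | 0, _ => Measure.dirac w₀
  | n + 1, φ =>
    ((noisyIterationLaw P ν η w₀ n fun i => φ i.castSucc).prod ν).map
      fun p => P (φ (Fin.last n) p.1 - η • p.2)

variable [BorelSpace E] {P : E → E} {ν : Measure E} {η : ℝ} {w₀ : E}

/-- One step back in time: translating the noise absorbs a fraction `1 / (m + 1)` of the gap `u -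
v`. A comparison of `F` and `G` at distance `m r` thus becomes one at distance `(m + 1) r` for their
averages over a noisy step, at the price of a factor `C`. -/
theorem lintegral_noisy_step_le {q : ℝ} (hq : 0 < q) (hη : η ≠ 0) (hP : LipschitzWith 1 P)
    {r : ℝ} {C : ℝ≥0∞} (hν : ∀ a, ‖η • a‖ ≤ r → ShiftBound ν q a C) {m : ℕ} {F G : E → ℝ≥0∞}
    (hG : Measurable G) {c : ℝ≥0∞} (hc : c ≠ ∞)
    (hFG : ∀ x y, ‖x - y‖ ≤ m * r → F x ≤ c * G y ^ (1 / q)) {u v : E}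
    (huv : ‖u - v‖ ≤ (m + 1 : ℕ) * r) :
    ∫⁻ z, F (P (u - η • z)) ∂ν ≤ c * C * (∫⁻ z, G (P (v - η • z)) ∂ν) ^ (1 / q) := by
  -- Chosen so that `v - η (z + a) = v - η z + (u - v) / (m + 1)`, leaving the gap `(m / (m + 1)) (u
  -- - v)`.
  set a : E := -(η⁻¹ • ((m + 1 : ℝ)⁻¹ • (u - v))) with ha
  have hm : (0 : ℝ) < m + 1 := by positivity
  push_cast at huv
  have hηa : η • a = -((m + 1 : ℝ)⁻¹ • (u - v)) := by
    rw [ha, smul_neg, smul_inv_smul₀ hη]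
  have har : ‖η • a‖ ≤ r := by
    rw [hηa, norm_neg, norm_smul, Real.norm_of_nonneg (by positivity), inv_mul_le_iff₀ hm]
    exact huv
  have hstep : Continuous fun z : E => P (v - η • z) := by
    have := hP.continuous
    fun_prop
  have hH : Measurable fun z : E => G (P (v - η • z)) ^ (1 / q) :=
    (hG.comp hstep.measurable).pow_const _
  have hpt : ∀ z, F (P (u - η • z)) ≤ c * G (P (v - η • (z + a))) ^ (1 / q) := by
    intro z
    refine hFG _ _ ?_
    have h1 := hP.norm_sub_le (u - η • z) (v - η • (z + a))
    have e : (u - η • z) - (v - η • (z + a)) = ((m : ℝ) * (m + 1 : ℝ)⁻¹) • (u - v) := by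
      rw [smul_add, hηa]
      have : ((m : ℝ) * (m + 1 : ℝ)⁻¹) = 1 - (m + 1 : ℝ)⁻¹ := by field_simp; ring
      rw [this]
      module
    rw [e, norm_smul, Real.norm_of_nonneg (by positivity)] at h1
    refine h1.trans ?_
    rw [NNReal.coe_one, one_mul, mul_assoc]
    gcongr
    rw [inv_mul_le_iff₀ hm]
    exact huv
  calc ∫⁻ z, F (P (u - η • z)) ∂ν ≤ ∫⁻ z, c * G (P (v - η • (z + a))) ^ (1 / q) ∂ν :=
        lintegral_mono hpt
    _ = c * ∫⁻ z, G (P (v - η • (z + a))) ^ (1 / q) ∂ν := lintegral_const_mul' _ _ hc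
    _ ≤ c * (C * (∫⁻ z, (G (P (v - η • z)) ^ (1 / q)) ^ q ∂ν) ^ (1 / q)) := by
        gcongr
        exact hν a har _ hH
    _ = c * C * (∫⁻ z, G (P (v - η • z)) ∂ν) ^ (1 / q) := by
        simp_rw [← ENNReal.rpow_mul, one_div_mul_cancel hq.ne', ENNReal.rpow_one, mul_assoc]

theorem lintegral_rpow_one_div_le {Ω : Type*} [MeasurableSpace Ω] {μ : Measure Ω}
    [IsProbabilityMeasure μ] {p q : ℝ} (hpq : p.HolderConjugate q) {G : Ω → ℝ≥0∞}
    (hG : AEMeasurable G μ) : ∫⁻ w, G w ^ (1 / q) ∂μ ≤ (∫⁻ w, G w ∂μ) ^ (1 / q) := by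
  have h := ENNReal.lintegral_mul_le_Lp_mul_Lq μ hpq (f := fun _ => 1) aemeasurable_const
    (hG.pow_const (1 / q))
  simpa [← ENNReal.rpow_mul, inv_mul_cancel₀ hpq.symm.pos.ne'] using h

variable [SecondCountableTopology E]

theorem measurable_noisy_step (hP : LipschitzWith 1 P) {ψ : E → E} (hψ : LipschitzWith 1 ψ) :
    Measurable fun p : E × E => P (ψ p.1 - η • p.2) := by
  have := hP.continuous
  have := hψ.continuous
  exact Continuous.measurable (by fun_prop)

theorem isProbabilityMeasure_noisyIterationLaw [IsProbabilityMeasure ν] (hP : LipschitzWith 1 P) :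
    ∀ {n : ℕ} {φ : Fin n → E → E}, (∀ i, LipschitzWith 1 (φ i)) →
      IsProbabilityMeasure (noisyIterationLaw P ν η w₀ n φ)
  | 0, _, _ => by
    unfold noisyIterationLaw
    infer_instance
  | n + 1, φ, hφ => by
    have := isProbabilityMeasure_noisyIterationLaw hP
      (φ := fun i : Fin n => φ i.castSucc) fun i => hφ _
    unfold noisyIterationLaw
    exact Measure.isProbabilityMeasure_map (measurable_noisy_step hP (hφ _)).aemeasurable

theorem ae_mem_noisyIterationLaw {s : Set E} (hs : MeasurableSet s) (hP : LipschitzWith 1 P)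
    (hPs : ∀ v, P v ∈ s) (hw₀ : w₀ ∈ s) :
    ∀ {n : ℕ} {φ : Fin n → E → E}, (∀ i, LipschitzWith 1 (φ i)) →
      ∀ᵐ w ∂(noisyIterationLaw P ν η w₀ n φ), w ∈ s
  | 0, _, _ => by
    unfold noisyIterationLaw
    exact (ae_dirac_iff hs).2 hw₀
  | n + 1, φ, hφ => by
    unfold noisyIterationLaw
    exact (ae_map_iff (measurable_noisy_step hP (hφ _)).aemeasurable hs).2
      (Filter.Eventually.of_forall fun p => hPs _)

theorem lintegral_noisyIterationLaw_succ [IsProbabilityMeasure ν] (hP : LipschitzWith 1 P) {n : ℕ}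
    {φ : Fin (n + 1) → E → E} (hφ : ∀ i, LipschitzWith 1 (φ i)) {F : E → ℝ≥0∞}
    (hF : Measurable F) :
    ∫⁻ w, F w ∂(noisyIterationLaw P ν η w₀ (n + 1) φ)
      = ∫⁻ w, ∫⁻ z, F (P (φ (Fin.last n) w - η • z)) ∂ν
        ∂(noisyIterationLaw P ν η w₀ n fun i => φ i.castSucc) := by
  have hm := measurable_noisy_step (η := η) hP (hφ (Fin.last n))
  rw [noisyIterationLaw, lintegral_map hF hm]
  exact lintegral_prod _ (hF.comp hm).aemeasurable

/-- Induction peeling off the last step. While the last step is after `t`, both runs use the same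
nonexpansive map, so the test functions are averaged over that step and the tolerated distance grows
from `m r` to `(m + 1) r`. At step `t` this distance covers `δ`; the laws before it coincide, and
the power `1 / q` comes out of the integral by `lintegral_rpow_one_div_le`. -/
theorem lintegral_noisyIterationLaw_le [IsProbabilityMeasure ν] {p q : ℝ}
    (hpq : p.HolderConjugate q) (hη : η ≠ 0) (hP : LipschitzWith 1 P) {r : ℝ} {C : ℝ≥0∞}
    (hC : C ≠ ∞) (hν : ∀ a, ‖η • a‖ ≤ r → ShiftBound ν q a C) {δ : ℝ} :
    ∀ {n : ℕ} {φ φ' : Fin n → E → E}, (∀ i, LipschitzWith 1 (φ i)) →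
      (∀ i, LipschitzWith 1 (φ' i)) → ∀ t : Fin n, (∀ i, i ≠ t → φ i = φ' i) →
      (∀ w, ‖φ t w - φ' t w‖ ≤ δ) → ∀ {m T : ℕ}, (t : ℕ) + T = n → δ ≤ (m + T : ℕ) * r →
      ∀ {F G : E → ℝ≥0∞}, Measurable F → Measurable G → ∀ {c : ℝ≥0∞}, c ≠ ∞ →
      (∀ x y, ‖x - y‖ ≤ m * r → F x ≤ c * G y ^ (1 / q)) →
      ∫⁻ w, F w ∂(noisyIterationLaw P ν η w₀ n φ)
        ≤ c * C ^ T * (∫⁻ w, G w ∂(noisyIterationLaw P ν η w₀ n φ')) ^ (1 / q)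
  | 0, _, _, _, _, t, _, _, _, _, _, _, _, _, _, _, _, _, _ => t.elim0
  | n + 1, φ, φ', hφ, hφ', t, heq, hδ, m, T, hT, hr, F, G, hF, hG, c, hc, hFG => by
    have hm := measurable_noisy_step (η := η) hP (hφ (Fin.last n))
    have hm' := measurable_noisy_step (η := η) hP (hφ' (Fin.last n))
    have hTF : Measurable fun w => ∫⁻ z, F (P (φ (Fin.last n) w - η • z)) ∂ν :=
      (hF.comp hm).lintegral_prod_right'
    have hTG : Measurable fun w => ∫⁻ z, G (P (φ' (Fin.last n) w - η • z)) ∂ν :=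
      (hG.comp hm').lintegral_prod_right'
    rw [lintegral_noisyIterationLaw_succ hP hφ hF, lintegral_noisyIterationLaw_succ hP hφ' hG]
    induction t using Fin.lastCases with
    | last =>
      have hT1 : T = 1 := by
        simp at hT
        omega
      subst hT1
      have e : (fun i : Fin n => φ i.castSucc) = fun i => φ' i.castSucc := by
        funext i
        exact heq _ (Fin.castSucc_lt_last i).ne
      have := isProbabilityMeasure_noisyIterationLaw (ν := ν) (η := η) (w₀ := w₀) hP
        (φ := fun i : Fin n => φ' i.castSucc) fun i => hφ' _
      rw [e, pow_one]
      calc _ ≤ ∫⁻ w, c * C * (∫⁻ z, G (P (φ' (Fin.last n) w - η • z)) ∂ν) ^ (1 / q)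
            ∂(noisyIterationLaw P ν η w₀ n fun i => φ' i.castSucc) :=
          lintegral_mono fun w => lintegral_noisy_step_le hpq.symm.pos hη hP hν hG hc hFG
            ((hδ w).trans hr)
        _ = c * C * ∫⁻ w, (∫⁻ z, G (P (φ' (Fin.last n) w - η • z)) ∂ν) ^ (1 / q)
            ∂(noisyIterationLaw P ν η w₀ n fun i => φ' i.castSucc) :=
          lintegral_const_mul' _ _ (ENNReal.mul_ne_top hc hC)
        _ ≤ _ := by
          gcongr
          exact lintegral_rpow_one_div_le hpq hTG.aemeasurable
    | cast t =>
      obtain ⟨T, rfl⟩ : ∃ T', T = T' + 1 := ⟨T - 1, by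
        have := t.isLt
        simp at hT
        omega⟩
      have hlast : φ (Fin.last n) = φ' (Fin.last n) := heq _ (Fin.castSucc_lt_last t).ne'
      have h := lintegral_noisyIterationLaw_le hpq hη hP hC hν (δ := δ)
        (φ := fun i : Fin n => φ i.castSucc) (φ' := fun i : Fin n => φ' i.castSucc)
        (fun i => hφ _) (fun i => hφ' _) t
        (fun i hi => heq _ fun h => hi (Fin.castSucc_injective _ h)) hδ (m := m + 1) (T := T)
        (by simp at hT; omega) (by convert hr using 3; omega) hTF hTG (ENNReal.mul_ne_top hc hC)
        (fun x y hxy => by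
          rw [hlast]
          refine lintegral_noisy_step_le hpq.symm.pos hη hP hν hG hc hFG ?_
          have := (hφ' (Fin.last n)).norm_sub_le x y
          rw [NNReal.coe_one, one_mul] at this
          exact this.trans hxy)
      refine h.trans_eq ?_
      rw [pow_succ']
      ring

end NoisyIteration

/-! ### From the dual bound to the Rényi divergence -/

section RenyiDual

variable {Ω : Type*} [MeasurableSpace Ω] {P Q : Measure Ω} {p q : ℝ} {M : ℝ≥0∞}

theorem absolutelyContinuous_of_lintegral_le (hq : 0 < q)
    (h : ∀ u : Ω → ℝ≥0∞, Measurable u → ∫⁻ x, u x ∂P ≤ M * (∫⁻ x, u x ^ q ∂Q) ^ (1 / q)) :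
    P ≪ Q := by
  refine Measure.AbsolutelyContinuous.mk fun s hs hQ => ?_
  have h1 := h (s.indicator 1) (measurable_one.indicator hs)
  have e : (fun x => s.indicator (1 : Ω → ℝ≥0∞) x ^ q) = s.indicator 1 := by
    funext x
    by_cases hx : x ∈ s <;> simp [hx, hq]
  rw [e, lintegral_indicator_one hs, lintegral_indicator_one hs, hQ,
    ENNReal.zero_rpow_of_pos (by positivity), mul_zero] at h1
  exact le_antisymm h1 zero_le

/-- The extremal test function is the `(p - 1)`-th power of the density. Truncating at `N` makes `A`
finite, so `A ≤ M * A ^ (1 / q)` can be divided through; monotone convergence removes the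
truncation. -/
theorem lintegral_rnDeriv_rpow_le [SigmaFinite P] [IsFiniteMeasure Q] (hpq : p.HolderConjugate q)
    (h : ∀ u : Ω → ℝ≥0∞, Measurable u → ∫⁻ x, u x ∂P ≤ M * (∫⁻ x, u x ^ q ∂Q) ^ (1 / q)) :
    ∫⁻ x, P.rnDeriv Q x ^ p ∂Q ≤ M ^ p := by
  have hp := hpq.pos
  have hac := absolutelyContinuous_of_lintegral_le hpq.symm.pos h
  set g := P.rnDeriv Q with hg
  have hgm : Measurable g := Measure.measurable_rnDeriv P Q
  have htrunc : ∀ N : ℕ, ∫⁻ x, (min (g x) N) ^ p ∂Q ≤ M ^ p := by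
    intro N
    have hmin : Measurable fun x => min (g x) (N : ℝ≥0∞) := hgm.min measurable_const
    set A := ∫⁻ x, (min (g x) N) ^ p ∂Q with hA
    have hAtop : A ≠ ∞ := by
      refine ne_top_of_le_ne_top (b := (N : ℝ≥0∞) ^ p * Q Set.univ)
        (ENNReal.mul_ne_top (by simp [hp.le]) (measure_ne_top _ _)) ?_
      rw [← lintegral_const]
      exact lintegral_mono fun x => ENNReal.rpow_le_rpow (min_le_right _ _) hp.le
    have h1 := h (fun x => (min (g x) N) ^ (p - 1)) (hmin.pow_const _)
    simp_rw [← ENNReal.rpow_mul, hpq.sub_one_mul_conj] at h1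
    have h2 : A ≤ ∫⁻ x, (min (g x) N) ^ (p - 1) ∂P := by
      conv_rhs => rw [← Measure.withDensity_rnDeriv_eq P Q hac]
      rw [lintegral_withDensity_eq_lintegral_mul _ hgm (hmin.pow_const _)]
      refine lintegral_mono fun x => ?_
      calc (min (g x) N) ^ p = (min (g x) N) ^ (1 + (p - 1)) := by ring_nf
        _ = min (g x) N * (min (g x) N) ^ (p - 1) := by
          rw [ENNReal.rpow_add_of_nonneg _ _ zero_le_one (sub_nonneg.2 hpq.lt.le),
            ENNReal.rpow_one]
        _ ≤ g x * (min (g x) N) ^ (p - 1) := by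
          gcongr
          exact min_le_left _ _
    have h3 := h2.trans h1
    by_cases hA0 : A = 0
    · rw [hA0]
      exact zero_le
    have e : A = A ^ (1 / p) * A ^ (1 / q) := by
      rw [← ENNReal.rpow_add _ _ hA0 hAtop, one_div, one_div, hpq.inv_add_inv_eq_one,
        ENNReal.rpow_one]
    have hq0 : A ^ (1 / q) ≠ 0 := by simp [hA0, hAtop]
    have hqt : A ^ (1 / q) ≠ ∞ := ENNReal.rpow_ne_top_of_nonneg (by
      have := hpq.symm.pos
      positivity) hAtop
    have h4 : A ^ (1 / p) ≤ M := by
      rw [← ENNReal.mul_le_mul_iff_left hq0 hqt, ← e]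
      exact h3
    rw [← ENNReal.rpow_le_rpow_iff hp, ← ENNReal.rpow_mul, one_div_mul_cancel hp.ne',
      ENNReal.rpow_one] at h4
    exact h4
  refine le_of_tendsto' (lintegral_tendsto_of_tendsto_of_monotone
    (f := fun (N : ℕ) x => (min (g x) N) ^ p) (fun N => ?_) ?_ ?_) htrunc
  · exact ((hgm.min measurable_const).pow_const p).aemeasurable
  · filter_upwards with x
    intro N N' hN
    dsimp only
    gcongr
  · filter_upwards with x
    have h1 : Filter.Tendsto (fun N : ℕ => min (g x) (N : ℝ≥0∞)) Filter.atTop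
        (nhds (min (g x) ∞)) := tendsto_const_nhds.min ENNReal.tendsto_nat_nhds_top
    rw [min_eq_left le_top] at h1
    exact (ENNReal.continuous_rpow_const.tendsto _).comp h1

theorem renyiDiv_le_of_lintegral_le [SigmaFinite P] [IsFiniteMeasure Q]
    (hpq : p.HolderConjugate q) {κ : ℝ}
    (h : ∀ u : Ω → ℝ≥0∞, Measurable u →
      ∫⁻ x, u x ∂P ≤ ENNReal.ofReal (Real.exp κ) * (∫⁻ x, u x ^ q ∂Q) ^ (1 / q)) :
    renyiDiv p P Q ≤ ((p / (p - 1) * κ : ℝ) : EReal) := by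
  have hp1 : 0 < p - 1 := sub_pos.2 hpq.lt
  rw [renyiDiv, if_pos (absolutelyContinuous_of_lintegral_le hpq.symm.pos h)]
  have h1 := ENNReal.log_monotone (lintegral_rnDeriv_rpow_le hpq h)
  rw [ENNReal.ofReal_rpow_of_pos (Real.exp_pos _), ← Real.exp_mul,
    ENNReal.log_ofReal_of_pos (Real.exp_pos _), Real.log_exp] at h1
  have h2 := mul_le_mul_of_nonneg_left h1 (a := (((p - 1)⁻¹ : ℝ) : EReal))
    (by exact_mod_cast (inv_pos.2 hp1).le)
  refine h2.trans_eq ?_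
  rw [← EReal.coe_mul]
  congr 1
  field_simp

theorem renyiDiv_self [IsProbabilityMeasure P] : renyiDiv p P P = 0 := by
  have h : ∫⁻ x, P.rnDeriv P x ^ p ∂P = 1 := by
    rw [lintegral_congr_ae (g := fun _ => 1)]
    · simp
    · filter_upwards [Measure.rnDeriv_self P] with x hx
      simp [hx]
  rw [renyiDiv, if_pos Measure.AbsolutelyContinuous.rfl, h]
  simp

end RenyiDual

/-! ### Projected noisy SGD as a noisy nonexpansive iteration -/

section ProjectedNoisySGD

variable {d : ℕ} {X : Type*} {K : Set (EuclideanSpace ℝ (Fin d))}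

/-- The gradient step along the component of `gradf` tangent to `K`, started at the projection onto
`K`. -/
noncomputable def tangentGradientStep (K : Set (EuclideanSpace ℝ (Fin d)))
    (gradf : EuclideanSpace ℝ (Fin d) → X → EuclideanSpace ℝ (Fin d)) (η : ℝ) (x : X)
    (w : EuclideanSpace ℝ (Fin d)) : EuclideanSpace ℝ (Fin d) :=
  metricProj K w - η • (vectorSpan ℝ K).starProjection (gradf (metricProj K w) x)

theorem pnsgdStep_eq_metricProj_tangentGradientStep (hK : IsClosed K) (hc : Convex ℝ K)
    (gradf : EuclideanSpace ℝ (Fin d) → X → EuclideanSpace ℝ (Fin d)) (η : ℝ) (x : X)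
    {w : EuclideanSpace ℝ (Fin d)} (hw : w ∈ K) (z : EuclideanSpace ℝ (Fin d)) :
    pnsgdStep K gradf η x w z = metricProj K (tangentGradientStep K gradf η x w - η • z) := by
  rw [pnsgdStep, tangentGradientStep, metricProj_of_mem hK hc hw]
  refine metricProj_eq_of_sub_mem_orthogonal hK hc ⟨w, hw⟩ ?_
  have e : w - η • (gradf w x + z)
      - (w - η • (vectorSpan ℝ K).starProjection (gradf w x) - η • z)
      = (-η) • (gradf w x - (vectorSpan ℝ K).starProjection (gradf w x)) := by
    module
  rw [e]
  exact Submodule.smul_mem _ _ (Submodule.sub_starProjection_mem_orthogonal _)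

theorem lipschitzWith_metricProj (hK : IsClosed K) (hc : Convex ℝ K) (hne : K.Nonempty) :
    LipschitzWith 1 (metricProj K) :=
  LipschitzWith.of_dist_le_mul fun v v' => by
    simpa [dist_eq_norm] using norm_metricProj_sub_le hK hc hne v v'

/-- The modified step is nonexpansive on the whole space and gives the same projected update at
points of `K`, where the iterates lie almost surely. -/
theorem pnsgdLaw_eq_noisyIterationLaw (hK : IsClosed K) (hc : Convex ℝ K)
    {gradf : EuclideanSpace ℝ (Fin d) → X → EuclideanSpace ℝ (Fin d)} {η : ℝ} (σ : ℝ)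
    (hstep : ∀ x, LipschitzWith 1 (tangentGradientStep K gradf η x))
    {w₀ : EuclideanSpace ℝ (Fin d)} (hw₀ : w₀ ∈ K) :
    ∀ (n : ℕ) (S : Fin n → X), pnsgdLaw K gradf η σ w₀ n S
      = noisyIterationLaw (metricProj K) (isotropicGaussian d σ) η w₀ n
        fun i => tangentGradientStep K gradf η (S i)
  | 0, _ => rfl
  | n + 1, S => by
    have hne : K.Nonempty := ⟨w₀, hw₀⟩
    have hP := lipschitzWith_metricProj hK hc hne
    rw [pnsgdLaw, noisyIterationLaw, pnsgdLaw_eq_noisyIterationLaw hK hc σ hstep hw₀ n]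
    have hprob := isProbabilityMeasure_noisyIterationLaw (ν := isotropicGaussian d σ) (η := η)
      (w₀ := w₀) hP (φ := fun i : Fin n => tangentGradientStep K gradf η (S i.castSucc))
      fun i => hstep _
    refine Measure.map_congr ?_
    have hae := ae_mem_noisyIterationLaw (ν := isotropicGaussian d σ) (η := η) hK.measurableSet hP
      (fun v => (metricProj_spec hK hne v).1) hw₀
      (φ := fun i : Fin n => tangentGradientStep K gradf η (S i.castSucc)) fun i => hstep _
    filter_upwards [Measure.quasiMeasurePreserving_fst.ae hae] with p hp
    exact pnsgdStep_eq_metricProj_tangentGradientStep hK hc gradf η _ hp _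

end ProjectedNoisySGD

theorem mainTheorem5 {d n : ℕ} {X : Type*} [MetricSpace X]
    (hX : Bornology.IsBounded (Set.univ : Set X))
    (K : Set (EuclideanSpace ℝ (Fin d))) (hKclosed : IsClosed K) (hKconv : Convex ℝ K)
    (f : EuclideanSpace ℝ (Fin d) → X → ℝ)
    (gradf : EuclideanSpace ℝ (Fin d) → X → EuclideanSpace ℝ (Fin d))
    (β Linput : ℝ≥0) (hβ : 0 < β)
    (hfconv : ∀ x, ConvexOn ℝ K fun w => f w x)
    (hgrad : ∀ x, ∀ w ∈ K, HasGradientWithinAt (fun u => f u x) (gradf w x) K w)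
    (hsmooth : ∀ x, LipschitzOnWith β (fun w => gradf w x) K)
    (hinput : ∀ w ∈ K, LipschitzWith Linput (gradf w))
    (η : ℝ) (hη0 : 0 ≤ η) (hη : η ≤ 2 / β)
    (α : ℝ) (hα : 1 < α) (ε : ℝ) (hε : 0 < ε)
    (w₀ : EuclideanSpace ℝ (Fin d)) (hw₀ : w₀ ∈ K)
    (t : Fin n) (σ : ℝ)
    (hσ : 2 * α * (Linput : ℝ) ^ 2 * Metric.diam (Set.univ : Set X)
        / (ε * ((n : ℝ) - ((t : ℕ) + 1 : ℝ) + 1)) ≤ σ ^ 2) :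
    IsRenyiMDPAt (pnsgdLaw K gradf η σ w₀ n) α ε t := by
  intro S S' hSS'
  have hne : K.Nonempty := ⟨w₀, hw₀⟩
  have hP := lipschitzWith_metricProj hKclosed hKconv hne
  have hmem : ∀ v, metricProj K v ∈ K := fun v => (metricProj_spec hKclosed hne v).1
  have hstep : ∀ x, LipschitzWith 1 (tangentGradientStep K gradf η x) := by
    refine fun x => LipschitzWith.of_dist_le_mul fun w w' => ?_
    rw [dist_eq_norm, dist_eq_norm, NNReal.coe_one, one_mul]
    exact (norm_gradient_step_sub_le (hfconv x) (hgrad x) hβ (hsmooth x) hη0 hη (hmem w)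
      (hmem w')).trans (norm_metricProj_sub_le hKclosed hKconv hne w w')
  set ρ := dist (S t) (S' t) with hρ
  have hρ0 : 0 ≤ ρ := dist_nonneg
  have hsum : ∑ i, dist (S i) (S' i) = ρ :=
    Finset.sum_eq_single t (fun i _ hi => by rw [hSS' i hi, dist_self]) (by simp)
  have hdiam : ρ ≤ Metric.diam (Set.univ : Set X) :=
    Metric.dist_le_diam_of_mem hX (Set.mem_univ _) (Set.mem_univ _)
  have hδ : ∀ w, ‖tangentGradientStep K gradf η (S t) w - tangentGradientStep K gradf η (S' t) w‖
      ≤ η * (Linput * ρ) := by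
    intro w
    rw [tangentGradientStep, tangentGradientStep, sub_sub_sub_cancel_left, ← smul_sub, ← map_sub,
      norm_smul, Real.norm_of_nonneg hη0]
    gcongr
    refine (Submodule.norm_starProjection_apply_le _ _).trans ?_
    rw [norm_sub_rev, ← dist_eq_norm]
    exact (hinput _ (hmem w)).dist_le_mul _ _
  have hlaw := pnsgdLaw_eq_noisyIterationLaw hKclosed hKconv σ hstep hw₀ n
  rw [hsum, hlaw, hlaw]
  have hprob : ∀ S : Fin n → X, IsProbabilityMeasure (noisyIterationLaw (metricProj K)
      (isotropicGaussian d σ) η w₀ n fun i => tangentGradientStep K gradf η (S i)) :=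
    fun S => isProbabilityMeasure_noisyIterationLaw hP fun i => hstep _
  have hprob1 := hprob S
  have hprob2 := hprob S'
  -- If `η L ρ = 0` the two laws coincide. This case is separate because `σ = 0` is then possible;
  -- otherwise the lower bound on `σ ^ 2` is positive.
  rcases (by positivity : 0 ≤ η * (Linput * ρ)).eq_or_lt with h0 | hpos
  · have e : (fun i => tangentGradientStep K gradf η (S i))
        = fun i => tangentGradientStep K gradf η (S' i) := by
      funext i w
      by_cases hi : i = t
      · subst hi
        have := hδ w
        rw [← h0] at this
        exact sub_eq_zero.1 (norm_le_zero_iff.1 this)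
      · rw [hSS' i hi]
    rw [e, renyiDiv_self]
    exact_mod_cast mul_nonneg hε.le hρ0
  · have hη' : 0 < η := hη0.lt_of_ne (by rintro rfl; simp at hpos)
    have hLρ : 0 < (Linput : ℝ) * ρ := pos_of_mul_pos_right hpos hη0
    have hL : (0 : ℝ) < Linput := pos_of_mul_pos_left hLρ hρ0
    have hρpos : 0 < ρ := pos_of_mul_pos_right hLρ hL.le
    obtain ⟨T, hT⟩ : ∃ T : ℕ, (t : ℕ) + T = n := ⟨n - t, by omega⟩
    have hTpos : (0 : ℝ) < T := by
      have := t.isLt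
      exact_mod_cast (by omega : 0 < T)
    -- `t` is counted from zero, so `T = n - t` is the number of steps from the altered one to the
    -- end, inclusive.
    have hTn : (n : ℝ) - ((t : ℕ) + 1 : ℝ) + 1 = T := by
      have : (n : ℝ) = (t : ℕ) + T := by exact_mod_cast hT.symm
      linarith
    rw [hTn, div_le_iff₀ (by positivity)] at hσ
    have hσ2 : 0 < σ ^ 2 := by
      have : 0 < 2 * α * (Linput : ℝ) ^ 2 * Metric.diam (Set.univ : Set X) :=
        mul_pos (by positivity) (hρpos.trans_le hdiam)
      exact pos_of_mul_pos_left (this.trans_le hσ) (by positivity)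
    have hσ0 : σ ≠ 0 := by
      rintro rfl
      simp at hσ2
    have hpq := Real.HolderConjugate.conjExponent hα
    set q := Real.conjExponent α
    set r : ℝ := η * (Linput * ρ) / T with hr
    set κ : ℝ := (α - 1) * (Linput * ρ / T) ^ 2 / (2 * σ ^ 2) with hκ
    have hν : ∀ a, ‖η • a‖ ≤ r →
        ShiftBound (isotropicGaussian d σ) q a (ENNReal.ofReal (Real.exp κ)) := by
      intro a ha F hF
      refine (shiftBound_isotropicGaussian hpq hσ0 a F hF).trans ?_
      have hα' : 0 ≤ α - 1 := by linarith
      have : ‖a‖ ≤ Linput * ρ / T := by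
        rw [norm_smul, Real.norm_of_nonneg hη0, hr, mul_div_assoc] at ha
        exact le_of_mul_le_mul_left ha hη'
      rw [hκ]
      gcongr
    -- The induction starts with `m = 0`, `c = 1`, `F = u` and `G = u ^ q`: at distance zero the
    -- comparison is an equality.
    have hmain := renyiDiv_le_of_lintegral_le hpq (κ := T * κ)
      (P := noisyIterationLaw (metricProj K) (isotropicGaussian d σ) η w₀ n
        fun i => tangentGradientStep K gradf η (S i))
      (Q := noisyIterationLaw (metricProj K) (isotropicGaussian d σ) η w₀ n
        fun i => tangentGradientStep K gradf η (S' i)) fun u hu => by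
      have h := lintegral_noisyIterationLaw_le (w₀ := w₀) hpq hη'.ne' hP ENNReal.ofReal_ne_top hν
        (fun i => hstep (S i)) (fun i => hstep (S' i)) t (fun i hi => by rw [hSS' i hi]) hδ
        (m := 0) hT (by
          rw [hr, zero_add]
          field_simp
          exact le_rfl) hu (hu.pow_const q) ENNReal.one_ne_top (fun x y hxy => by
          have hxy : x = y := by
            simpa [sub_eq_zero] using hxy
          rw [hxy, ← ENNReal.rpow_mul, mul_one_div_cancel hpq.symm.pos.ne', ENNReal.rpow_one,
            one_mul])
      rwa [one_mul, ← ENNReal.ofReal_pow (Real.exp_pos _).le, ← Real.exp_nat_mul] at h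
    refine hmain.trans ?_
    have hα' : 0 < α - 1 := by linarith
    have e : α / (α - 1) * (T * κ) = α * Linput ^ 2 * ρ ^ 2 / (2 * T * σ ^ 2) := by
      rw [hκ]
      field_simp
    rw [e, EReal.coe_le_coe_iff, div_le_iff₀ (by positivity)]
    -- One factor `ρ` is bounded by the diameter and the other is kept; the assumption on `σ` leaves
    -- a factor `4` to spare.
    have h1 : 2 * α * (Linput : ℝ) ^ 2 * ρ ≤ σ ^ 2 * (ε * T) := le_trans (by gcongr) hσ
    have h2 : 0 ≤ σ ^ 2 * (ε * T) := by positivity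
    nlinarith [mul_le_mul_of_nonneg_right h1 hρ0, mul_nonneg h2 hρ0]
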